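/- Let $(\Omega,\mathcal F,\mathbb P)$ be a probability space, and let $\theta$ be a random element (the noise that corrupts the objective evaluations). Consider a random-subspace trust-region method with deterministic starting point $x_0\in\mathbb R^n$ that at iterations $k=0,1,2,\dots$ uses random matrices $Q_k\in\mathbb R^{n\times p}$, random models $\hat m_k:\mathbb R^p\to\mathbb R$ and random estimates $f_k^0,f_k^s\in\mathbb R$, where $\hat m_k,f_k^0,f_k^s$ are measurable functions of $\theta$ and $Q_0,\dots,Q_k$. Let $$\mathcal F_{k-1}=\sigma\big(f_\ell^0,f_\ell^s,\hat m_\ell,Q_\ell:\ 0\le\ell\le k-1\big)\quad(k\ge1),\qquad \mathcal F_{-1}=\sigma(x_0)$$ ($\sigma(\hat m_\ell)$ is generated by the values $\hat m_\ell(s)$, $s\in\mathbb R^p$). Let $\alpha\in(0,1)$ and $\beta\in(0,1/2)$. The sequence $(Q_k)$ is called $(1-\beta)$-probabilistically $\alpha$-well aligned if for every $k$ and every $\mathcal F_{k-1}$-measurable random vector $v$ in $\mathbb R^n$, $$\mathbb P\big(\|Q_k^{\top}v\|_2\ge\alpha\|v\|_2\ \big|\ \mathcal F_{k-1}\big)\ge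 1-\beta\quad\text{almost surely.}\tag{1}$$ A random matrix $S=(s_{ij})\in\mathbb R^{p\times n}$ is called a hashing matrix with parameters $\varepsilon,\beta$ if $s_{ij}=\frac1{\sqrt r}\,\eta_{ij}\sigma_{ij}$ for some integer $r\ge1$, some real $\ell\ge2$, and random variables $\eta_{ij},\sigma_{ij}$ such that * the $\sigma_{ij}$ are independent Rademacher variables, and the family $(\sigma_{ij})$ is independent of the family $(\eta_{ij})$; * $\eta_{ij}\in\{0,1\}$, $\mathbb P\big[\sum_{i=1}^p\eta_{ij}=r\big]=1$ for every $j$, and $\mathbb E\big[\prod_{(i,j)\in T}\eta_{ij}\big]\le(r/p)^{|T|}$ for every $T\subseteq\{1,\dots,p\}\times\{1,\dots,n\}$ with $|T|\le\ell$; * $\ell\ge\ln\big[\beta^{-1}(\ell+1)\ell/2\big]$, $\ r\ge 8e^4\sqrt e\,(\ell+1)/(2\varepsilon-\varepsilon^2)$ and $p\ge 2r^2/(e\ell)$. Claim. If, at an iteration $k$, $Q_k^{\top}$ is a hashing matrix with $\varepsilon=1-\alpha$ and failure parameter $\beta$, and $Q_k$ is independent of $(Q_0,\dots,Q_{k-1},\theta)$,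 then (1) holds at iteration $k$ for every $\mathcal F_{k-1}$-measurable $v$. Consequently, if this is the case at every iteration $k$ (where $r,\ell,\eta,\sigma$ may depend on $k$), then $(Q_k)$ is $(1-\beta)$-probabilistically $\alpha$-well aligned. -/

import Mathlib

open MeasureTheory ProbabilityTheory
open scoped Matrix

noncomputable section

namespace STARS

/-- A real random variable that takes the values `1` and `-1` with probability `1/2` each. -/
structure IsRademacher {Ω : Type*} [MeasurableSpace Ω] (μ : Measure Ω) (X : Ω → ℝ) : Prop where
  measurable : Measurable X
  prob_one : μ {ω | X ω = 1} = 1 / 2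
  prob_neg_one : μ {ω | X ω = -1} = 1 / 2

/-- The construction of the sparse sign (hashing) Johnson--Lindenstrauss matrix
`S = (s_ij) ∈ ℝ^{p × n}`, `s_ij = η_ij σ_ij / √r`, with accuracy `ε` and failure probability `β`.
Here `r` is the number of nonzero entries per column, `ℓ` is the order up to which the sparsity
indicators `η` are negatively correlated, and `σ` are the signs. -/
structure IsHashingConstruction {Ω : Type*} [MeasurableSpace Ω] (μ : Measure Ω) {p n : ℕ}
    (ε β : ℝ) (S : Ω → Matrix (Fin p) (Fin n) ℝ) (r : ℕ) (ℓ : ℝ)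
    (η σ : Fin p × Fin n → Ω → ℝ) : Prop where
  /-- entries of the matrix -/
  entry : ∀ ω i j, S ω i j = 1 / √(r : ℝ) * η (i, j) ω * σ (i, j) ω
  r_pos : 0 < r
  /-- the signs are independent Rademacher variables ... -/
  rademacher : ∀ a, IsRademacher μ (σ a)
  indep_signs : iIndepFun σ μ
  /-- ... and the family of signs is independent of the sparsity pattern -/
  indep_pattern : IndepFun (fun ω a => σ a ω) (fun ω a => η a ω) μ
  /-- the `η a` are indicator random variables -/
  measurable_indicator : ∀ a, Measurable (η a)
  indicator : ∀ a ω, η a ω = 0 ∨ η a ω = 1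
  /-- almost surely every column has exactly `r` nonzero entries -/
  column_sum : ∀ j, ∀ᵐ ω ∂μ, ∑ i, η (i, j) ω = (r : ℝ)
  /-- negative correlation up to order `ℓ` -/
  two_le : 2 ≤ ℓ
  neg_corr : ∀ T : Finset (Fin p × Fin n), (T.card : ℝ) ≤ ℓ →
    ∫ ω, ∏ a ∈ T, η a ω ∂μ ≤ ((r : ℝ) / (p : ℝ)) ^ T.card
  /-- choice of the parameters -/
  order_ge : Real.log (β⁻¹ * ((ℓ + 1) * ℓ / 2)) ≤ ℓ
  sparsity_ge : 8 * Real.exp 4 * √(Real.exp 1) * (ℓ + 1) / (2 * ε - ε ^ 2) ≤ (r : ℝ)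
  rows_ge : 2 * (r : ℝ) ^ 2 / (Real.exp 1 * ℓ) ≤ (p : ℝ)

/-- `S` is a hashing Johnson--Lindenstrauss matrix with accuracy `ε` and failure probability
`β`, for some admissible choice of the remaining parameters. -/
def IsHashingMatrix {Ω : Type*} [MeasurableSpace Ω] (μ : Measure Ω) {p n : ℕ}
    (ε β : ℝ) (S : Ω → Matrix (Fin p) (Fin n) ℝ) : Prop :=
  ∃ (r : ℕ) (ℓ : ℝ) (η σ : Fin p × Fin n → Ω → ℝ), IsHashingConstruction μ ε β S r ℓ η σ

/-- The random quantities of the random-subspace trust-region method that generate its history: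
the starting point, and for every iteration the subspace matrix `Q k ∈ ℝ^{n × p}`, the random
model on `ℝ^p`, and the estimates of the objective at the current and at the trial point. -/
structure SubspaceMethod (Ω : Type*) (n p : ℕ) where
  x₀ : EuclideanSpace ℝ (Fin n)
  Q : ℕ → Ω → Matrix (Fin n) (Fin p) ℝ
  model : ℕ → Ω → EuclideanSpace ℝ (Fin p) → ℝ
  est0 : ℕ → Ω → ℝ
  estS : ℕ → Ω → ℝ

namespace SubspaceMethod

variable {Ω : Type*} {n p : ℕ} (A : SubspaceMethod Ω n p)

/-- `A.past k` is the σ-algebra `ℱ_{k-1}` of the history before iteration `k`. A random model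
generates the σ-algebra generated by its values at all points of `ℝ^p`. -/
def past : ℕ → MeasurableSpace Ω
  | 0 => MeasurableSpace.comap (fun _ : Ω => A.x₀) inferInstance
  | k + 1 => ⨆ l : Fin (k + 1),
      MeasurableSpace.comap (A.est0 l) inferInstance ⊔
      MeasurableSpace.comap (A.estS l) inferInstance ⊔
      (⨆ s : EuclideanSpace ℝ (Fin p),
        MeasurableSpace.comap (fun ω => A.model l ω s) inferInstance) ⊔
      (⨆ (i : Fin n) (j : Fin p), MeasurableSpace.comap (fun ω => A.Q l ω i j) inferInstance)

/-- The σ-algebra generated by the noise `θ` and by the matrices `Q l`, `l < k`. -/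
def noiseAndMatrices {Θ : Type*} [MeasurableSpace Θ] (θ : Ω → Θ) (k : ℕ) : MeasurableSpace Ω :=
  MeasurableSpace.comap θ inferInstance ⊔
    ⨆ (l : Fin k) (i : Fin n) (j : Fin p),
      MeasurableSpace.comap (fun ω => A.Q l ω i j) inferInstance

/-- The process is driven by the noise `θ` of the function evaluations: the matrices are random
matrices, and the models and the estimates of iteration `k` are constructed from `θ` and the
matrices `Q 0, …, Q k`. -/
structure IsDrivenBy [MeasurableSpace Ω] {Θ : Type*} [MeasurableSpace Θ] (θ : Ω → Θ) : Prop where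
  measurable_noise : Measurable θ
  measurable_Q : ∀ k i j, Measurable fun ω => A.Q k ω i j
  model : ∀ k s, Measurable[A.noiseAndMatrices θ (k + 1)] fun ω => A.model k ω s
  est0 : ∀ k, Measurable[A.noiseAndMatrices θ (k + 1)] (A.est0 k)
  estS : ∀ k, Measurable[A.noiseAndMatrices θ (k + 1)] (A.estS k)

/-- `Q k` is independent of `Q 0, …, Q (k - 1)` and `θ` (jointly). -/
def IndepOfPast [MeasurableSpace Ω] (μ : Measure Ω) {Θ : Type*} [MeasurableSpace Θ] (θ : Ω → Θ)
    (k : ℕ) : Prop :=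
  Indep (⨆ (i : Fin n) (j : Fin p), MeasurableSpace.comap (fun ω => A.Q k ω i j) inferInstance)
    (A.noiseAndMatrices θ k) μ

/-- The event `𝒜_k = {‖Q_kᵀ v‖ ≥ α ‖v‖}` for a random vector `v` (Euclidean norms). -/
def alignEvent (α : ℝ) (k : ℕ) (v : Ω → EuclideanSpace ℝ (Fin n)) : Set Ω :=
  {ω | α * ‖v ω‖ ≤ ‖WithLp.toLp 2 ((A.Q k ω)ᵀ *ᵥ (v ω).ofLp)‖}

/-- The matrix of iteration `k` is well aligned conditionally on the past: for every
`ℱ_{k-1}`-measurable random vector `v`, `ℙ(𝒜_k | ℱ_{k-1}) ≥ 1 - β` almost surely. -/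
def IsWAMAt [MeasurableSpace Ω] (μ : Measure Ω) (α β : ℝ) (k : ℕ) : Prop :=
  ∀ v : Ω → EuclideanSpace ℝ (Fin n), Measurable[A.past k] v →
    ∀ᵐ ω ∂μ, 1 - β ≤ (μ⟦A.alignEvent α k v | A.past k⟧) ω

/-- The sequence `(Q_k)` is `(1 - β)`-probabilistically `α`-well aligned. -/
def IsProbWellAligned [MeasurableSpace Ω] (μ : Measure Ω) (α β : ℝ) : Prop :=
  ∀ k, A.IsWAMAt μ α β k

end SubspaceMethod

end STARS

end

/-! The history before iteration `k` is a function of `θ` and the earlier matrices, hence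
independent of `Q k`. It can therefore be frozen (`measure_inter_fiber_le`,
`isWAMAt_of_forall_fixed`), and only the lower tail of ‖S x‖ for a fixed unit vector x is needed.

For a fixed pattern η with column sums r, the variable r‖S x‖² is a sum over rows of squares of
independent Rademacher sums, with mean r. Only deviations below the mean matter, so every row
contributes an exponent of at most 1, where exp y ≤ 1 + y + y² turns the variance of the row into an
exponential moment. Multiplying over rows and applying Chernoff's bound gives P(r‖S x‖² ≤ r - t) ≤
exp(2W - t), where W is `patternEnergy` (`measure_sum_rows_le`).

It remains to see that W = O(ℓ) with high probability. W averages the overlaps of pairs of distinct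
columns with weights x_j² x_k². An m-th factorial moment of an overlap involves products of 2m
indicators, which negative correlation controls when 2m ≤ ℓ (`integral_overlap_le`); Jensen and
Markov then bound the tail of W (`measure_patternEnergy_ge_le`). Large W, and a small norm despite
small W, each have probability at most exp(-ℓ), and 2 exp(-ℓ) ≤ β. -/

namespace STARS

/-! ### Moments and lower tails of Rademacher sums with fixed coefficients. -/

section Signs

variable {Ω : Type*} [MeasurableSpace Ω] {μ : Measure Ω}

theorem IsRademacher.ae_eq_or [IsProbabilityMeasure μ] {X : Ω → ℝ} (h : IsRademacher μ X) :
    ∀ᵐ ω ∂μ, X ω = 1 ∨ X ω = -1 := by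
  have h1 : MeasurableSet {ω | X ω = 1} := h.measurable (measurableSet_singleton 1)
  have h2 : MeasurableSet {ω | X ω = -1} := h.measurable (measurableSet_singleton (-1))
  have hd : Disjoint {ω | X ω = 1} {ω | X ω = -1} := by
    rw [Set.disjoint_left]
    intro ω (h : X ω = 1) (h' : X ω = -1)
    linarith
  have hu : μ ({ω | X ω = 1} ∪ {ω | X ω = -1}) = 1 := by
    rw [measure_union hd h2, h.prob_one, h.prob_neg_one, ENNReal.add_halves]
  exact (prob_compl_eq_zero_iff (h1.union h2)).2 hu

theorem IsRademacher.ae_sq [IsProbabilityMeasure μ] {X : Ω → ℝ} (h : IsRademacher μ X) :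
    ∀ᵐ ω ∂μ, X ω ^ 2 = 1 := by
  filter_upwards [h.ae_eq_or] with ω hω
  rcases hω with hω | hω <;> simp [hω]

theorem IsRademacher.integral_eq_zero [IsProbabilityMeasure μ] {X : Ω → ℝ}
    (h : IsRademacher μ X) : ∫ ω, X ω ∂μ = 0 := by
  have h1 : MeasurableSet {ω | X ω = 1} := h.measurable (measurableSet_singleton 1)
  have h2 : MeasurableSet {ω | X ω = -1} := h.measurable (measurableSet_singleton (-1))
  have hX : X =ᵐ[μ] fun ω => {ω | X ω = 1}.indicator (fun _ => (1 : ℝ)) ω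
      - {ω | X ω = -1}.indicator (fun _ => (1 : ℝ)) ω := by
    filter_upwards [h.ae_eq_or] with ω hω
    rcases hω with hω | hω <;> simp [Set.indicator, hω] <;> norm_num
  rw [integral_congr_ae hX, integral_sub ((integrable_const _).indicator h1)
    ((integrable_const _).indicator h2), integral_indicator_const _ h1,
    integral_indicator_const _ h2, measureReal_def, measureReal_def, h.prob_one, h.prob_neg_one,
    sub_self]

theorem integrable_continuous_comp_of_bound [IsFiniteMeasure μ] {X : Ω → ℝ} (hX : Measurable X)
    {B : ℝ} (hB : ∀ᵐ ω ∂μ, |X ω| ≤ B) {g : ℝ → ℝ} (hg : Continuous g) :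
    Integrable (fun ω => g (X ω)) μ := by
  obtain ⟨C, hC⟩ := (isCompact_Icc (a := -B) (b := B)).exists_bound_of_continuousOn
    hg.continuousOn
  refine Integrable.of_bound (hg.measurable.comp hX).aestronglyMeasurable C ?_
  filter_upwards [hB] with ω hω
  exact hC _ (abs_le.1 hω)

theorem integral_sign_mul_comp [IsProbabilityMeasure μ] {X Y : Ω → ℝ} (hX : IsRademacher μ X)
    (hY : Measurable Y) (hYX : IndepFun Y X μ) {g : ℝ → ℝ} (hg : Continuous g) :
    ∫ ω, X ω * g (Y ω) ∂μ = 0 := by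
  have := hYX.symm.integral_fun_comp_mul_comp (f := fun x => x) (g := g)
    hX.measurable.aemeasurable hY.aemeasurable measurable_id.aestronglyMeasurable
    hg.measurable.aestronglyMeasurable
  rw [this, hX.integral_eq_zero, zero_mul]

variable {ι : Type*} {σ : ι → Ω → ℝ}

theorem measurable_sign_sum (hσ : ∀ i, IsRademacher μ (σ i)) (a : ι → ℝ) (s : Finset ι) :
    Measurable fun ω => ∑ i ∈ s, a i * σ i ω :=
  Finset.measurable_fun_sum _ fun i _ => (hσ i).measurable.const_mul _

theorem abs_sign_sum_le [IsProbabilityMeasure μ] (hσ : ∀ i, IsRademacher μ (σ i)) (a : ι → ℝ)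
    (s : Finset ι) : ∀ᵐ ω ∂μ, |∑ i ∈ s, a i * σ i ω| ≤ ∑ i ∈ s, |a i| := by
  have : ∀ᵐ ω ∂μ, ∀ i ∈ s, σ i ω = 1 ∨ σ i ω = -1 :=
    (Filter.eventually_all_finset s).2 fun i _ => (hσ i).ae_eq_or
  filter_upwards [this] with ω hω
  refine (Finset.abs_sum_le_sum_abs _ _).trans (Finset.sum_le_sum fun i hi => ?_)
  rcases hω i hi with h | h <;> simp [h]

theorem integrable_comp_sign_sum [IsProbabilityMeasure μ] (hσ : ∀ i, IsRademacher μ (σ i))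
    (a : ι → ℝ) (s : Finset ι) {g : ℝ → ℝ} (hg : Continuous g) :
    Integrable (fun ω => g (∑ i ∈ s, a i * σ i ω)) μ :=
  integrable_continuous_comp_of_bound (measurable_sign_sum hσ a s) (abs_sign_sum_le hσ a s) hg

theorem integrable_sign_mul_comp_sign_sum [IsProbabilityMeasure μ]
    (hσ : ∀ i, IsRademacher μ (σ i)) (a : ι → ℝ) (s : Finset ι) (j : ι) {g : ℝ → ℝ}
    (hg : Continuous g) : Integrable (fun ω => σ j ω * g (∑ i ∈ s, a i * σ i ω)) μ := by
  refine (integrable_comp_sign_sum hσ a s hg).bdd_mul (c := 1)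
    (hσ j).measurable.aestronglyMeasurable ?_
  filter_upwards [(hσ j).ae_eq_or] with ω hω
  rcases hω with h | h <;> simp [h]

theorem indepFun_sign_sum (hσ : ∀ i, IsRademacher μ (σ i)) (hi : iIndepFun σ μ) (a : ι → ℝ)
    {s : Finset ι} {j : ι} (hj : j ∉ s) :
    IndepFun (fun ω => ∑ i ∈ s, a i * σ i ω) (σ j) μ := by
  have h := hi.indepFun_finset s {j} (by simpa using hj) fun i => (hσ i).measurable
  have hφ : Measurable fun f : s → ℝ => ∑ i : s, a i * f i := by fun_prop
  have hψ : Measurable fun f : ({j} : Finset ι) → ℝ => f ⟨j, by simp⟩ := measurable_pi_apply _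
  have := h.comp hφ hψ
  convert this using 1
  · funext ω
    exact (Finset.sum_coe_sort s fun i => a i * σ i ω).symm
  · rfl

theorem integral_sign_sum_sq [IsProbabilityMeasure μ] (hσ : ∀ i, IsRademacher μ (σ i))
    (hi : iIndepFun σ μ) (a : ι → ℝ) (s : Finset ι) :
    ∫ ω, (∑ i ∈ s, a i * σ i ω) ^ 2 ∂μ = ∑ i ∈ s, a i ^ 2 := by
  classical
  induction s using Finset.induction_on with
  | empty => simp
  | insert j s hj ih =>
    have hae : (fun ω => (∑ i ∈ insert j s, a i * σ i ω) ^ 2) =ᵐ[μ] fun ω =>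
        a j ^ 2 + 2 * a j * (σ j ω * (∑ i ∈ s, a i * σ i ω)) + (∑ i ∈ s, a i * σ i ω) ^ 2 := by
      filter_upwards [(hσ j).ae_sq] with ω hω
      rw [Finset.sum_insert hj]
      linear_combination a j ^ 2 * hω
    have i1 : Integrable (fun ω => 2 * a j * (σ j ω * (∑ i ∈ s, a i * σ i ω))) μ :=
      (integrable_sign_mul_comp_sign_sum hσ a s j continuous_id).const_mul _
    have i2 : Integrable (fun ω => (∑ i ∈ s, a i * σ i ω) ^ 2) μ :=
      integrable_comp_sign_sum hσ a s (continuous_pow 2)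
    have i3 : Integrable (fun ω => a j ^ 2 + 2 * a j * (σ j ω * (∑ i ∈ s, a i * σ i ω))) μ :=
      (integrable_const _).add i1
    have h0 : ∫ ω, σ j ω * (∑ i ∈ s, a i * σ i ω) ∂μ = 0 :=
      integral_sign_mul_comp (hσ j) (measurable_sign_sum hσ a s) (indepFun_sign_sum hσ hi a hj)
        continuous_id
    rw [integral_congr_ae hae, integral_add i3 i2, integral_add (integrable_const _) i1,
      integral_const_mul, h0, ih, Finset.sum_insert hj]
    simp

/-- The variance of the square of a Rademacher sum. -/
theorem integral_sign_sum_sq_sub_sq [IsProbabilityMeasure μ] (hσ : ∀ i, IsRademacher μ (σ i))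
    (hi : iIndepFun σ μ) (a : ι → ℝ) (s : Finset ι) :
    ∫ ω, ((∑ i ∈ s, a i * σ i ω) ^ 2 - ∑ i ∈ s, a i ^ 2) ^ 2 ∂μ
      = 2 * ((∑ i ∈ s, a i ^ 2) ^ 2 - ∑ i ∈ s, a i ^ 4) := by
  classical
  induction s using Finset.induction_on with
  | empty => simp
  | insert j s hj ih =>
    set v := ∑ i ∈ s, a i ^ 2 with hv
    -- Since σ_j² = 1, adding the index j changes X² - v into X² - v + 2 a_j σ_j X. Squaring leaves
    -- one term linear in σ_j, of mean zero by independence, and 4 a_j² X².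
    have hae : (fun ω => ((∑ i ∈ insert j s, a i * σ i ω) ^ 2 - ∑ i ∈ insert j s, a i ^ 2) ^ 2)
        =ᵐ[μ] fun ω => ((∑ i ∈ s, a i * σ i ω) ^ 2 - v) ^ 2
          + 4 * a j * (σ j ω * ((∑ i ∈ s, a i * σ i ω) * ((∑ i ∈ s, a i * σ i ω) ^ 2 - v)))
          + 4 * a j ^ 2 * (∑ i ∈ s, a i * σ i ω) ^ 2 := by
      filter_upwards [(hσ j).ae_eq_or] with ω hω
      rw [Finset.sum_insert hj, Finset.sum_insert hj, ← hv]
      rcases hω with h | h <;> rw [h] <;> ring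
    have i1 : Integrable (fun ω => ((∑ i ∈ s, a i * σ i ω) ^ 2 - v) ^ 2) μ :=
      integrable_comp_sign_sum hσ a s (g := fun x => (x ^ 2 - v) ^ 2) (by fun_prop)
    have i2 : Integrable (fun ω => 4 * a j * (σ j ω * ((∑ i ∈ s, a i * σ i ω)
        * ((∑ i ∈ s, a i * σ i ω) ^ 2 - v)))) μ :=
      (integrable_sign_mul_comp_sign_sum hσ a s j (g := fun x => x * (x ^ 2 - v))
        (by fun_prop)).const_mul _
    have i3 : Integrable (fun ω => 4 * a j ^ 2 * (∑ i ∈ s, a i * σ i ω) ^ 2) μ :=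
      (integrable_comp_sign_sum hσ a s (continuous_pow 2)).const_mul _
    have h0 : ∫ ω, σ j ω * ((∑ i ∈ s, a i * σ i ω)
        * ((∑ i ∈ s, a i * σ i ω) ^ 2 - v)) ∂μ = 0 :=
      integral_sign_mul_comp (hσ j) (measurable_sign_sum hσ a s) (indepFun_sign_sum hσ hi a hj)
        (g := fun x => x * (x ^ 2 - v)) (by fun_prop)
    have i12 : Integrable (fun ω => ((∑ i ∈ s, a i * σ i ω) ^ 2 - v) ^ 2
        + 4 * a j * (σ j ω * ((∑ i ∈ s, a i * σ i ω) * ((∑ i ∈ s, a i * σ i ω) ^ 2 - v)))) μ :=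
      i1.add i2
    rw [integral_congr_ae hae, integral_add i12 i3, integral_add i1 i2,
      integral_const_mul, integral_const_mul, h0, ih, integral_sign_sum_sq hσ hi,
      Finset.sum_insert hj, Finset.sum_insert hj, ← hv]
    ring

/-- A second-order bound with no lower restriction on y: this is why the lower tail of a square
needs only its variance. -/
theorem exp_le_one_add_add_sq {y : ℝ} (hy : y ≤ 1) : Real.exp y ≤ 1 + y + y ^ 2 := by
  rcases le_total (-1) y with h | h
  · have := abs_le.1 (Real.abs_exp_sub_one_sub_id_le (abs_le.2 ⟨h, hy⟩))
    linarith [this.2]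
  · have : Real.exp y ≤ 1 := Real.exp_le_one_iff.2 (by linarith)
    nlinarith

/-- One-sided exponential moment of the square of a Rademacher sum of variance at most one. -/
theorem integral_exp_sub_sign_sum_sq_le [IsProbabilityMeasure μ]
    (hσ : ∀ i, IsRademacher μ (σ i)) (hi : iIndepFun σ μ) (a : ι → ℝ) (s : Finset ι)
    (hv : ∑ i ∈ s, a i ^ 2 ≤ 1) :
    ∫ ω, Real.exp (∑ i ∈ s, a i ^ 2 - (∑ i ∈ s, a i * σ i ω) ^ 2) ∂μ
      ≤ Real.exp (2 * ((∑ i ∈ s, a i ^ 2) ^ 2 - ∑ i ∈ s, a i ^ 4)) := by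
  have h4 := integral_sign_sum_sq_sub_sq hσ hi a s
  have h2 := integral_sign_sum_sq hσ hi a s
  set v := ∑ i ∈ s, a i ^ 2 with hvdef
  have i1 : Integrable (fun ω => v - (∑ i ∈ s, a i * σ i ω) ^ 2) μ :=
    integrable_comp_sign_sum hσ a s (g := fun x => v - x ^ 2) (by fun_prop)
  have i2 : Integrable (fun ω => ((∑ i ∈ s, a i * σ i ω) ^ 2 - v) ^ 2) μ :=
    integrable_comp_sign_sum hσ a s (g := fun x => (x ^ 2 - v) ^ 2) (by fun_prop)
  have i3 : Integrable (fun ω => (∑ i ∈ s, a i * σ i ω) ^ 2) μ :=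
    integrable_comp_sign_sum hσ a s (continuous_pow 2)
  have i4 : Integrable (fun ω => 1 + (v - (∑ i ∈ s, a i * σ i ω) ^ 2)) μ :=
    (integrable_const _).add i1
  calc ∫ ω, Real.exp (v - (∑ i ∈ s, a i * σ i ω) ^ 2) ∂μ
      ≤ ∫ ω, (1 + (v - (∑ i ∈ s, a i * σ i ω) ^ 2)
          + ((∑ i ∈ s, a i * σ i ω) ^ 2 - v) ^ 2) ∂μ := by
        refine integral_mono (integrable_comp_sign_sum hσ a s
          (g := fun x => Real.exp (v - x ^ 2)) (by fun_prop)) (i4.add i2) fun ω => ?_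
        refine (exp_le_one_add_add_sq ?_).trans_eq (by ring)
        nlinarith [sq_nonneg (∑ i ∈ s, a i * σ i ω)]
    _ = 2 * (v ^ 2 - ∑ i ∈ s, a i ^ 4) + 1 := by
        rw [integral_add i4 i2, integral_add (integrable_const _) i1,
          integral_sub (integrable_const _) i3, h4, h2]
        simp
        ring
    _ ≤ _ := Real.add_one_le_exp _

variable {κ : Type*} [Fintype κ]

/-- Exponential moment of a sum of squares of Rademacher sums over the rows of a matrix. -/
theorem integral_exp_sum_rows_le [IsProbabilityMeasure μ] {σ : ι × κ → Ω → ℝ}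
    (hσ : ∀ i, IsRademacher μ (σ i)) (hi : iIndepFun σ μ) (a : ι → κ → ℝ)
    (hv : ∀ i, ∑ j, a i j ^ 2 ≤ 1) (s : Finset ι) :
    ∫ ω, Real.exp (∑ i ∈ s, (∑ j, a i j ^ 2 - (∑ j, a i j * σ (i, j) ω) ^ 2)) ∂μ
      ≤ Real.exp (2 * ∑ i ∈ s, ((∑ j, a i j ^ 2) ^ 2 - ∑ j, a i j ^ 4)) := by
  classical
  induction s using Finset.induction_on with
  | empty => simp
  | insert i₀ s hs ih =>
    have hrow := integral_exp_sub_sign_sum_sq_le (fun j => hσ (i₀, j))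
      (hi.precomp (Prod.mk_right_injective i₀)) (a i₀) Finset.univ (hv i₀)
    -- Distinct rows use disjoint sets of signs, so the exponential moment factorises.
    have hind := hi.indepFun_finset ({i₀} ×ˢ Finset.univ) (s ×ˢ Finset.univ)
      (Finset.disjoint_product.2 (Or.inl (by simpa using hs))) fun b => (hσ b).measurable
    have hφ : Measurable
        fun f : ((({i₀} : Finset ι) ×ˢ (Finset.univ : Finset κ) : Finset (ι × κ)) → ℝ) =>
          Real.exp (∑ j, a i₀ j ^ 2 - (∑ j, a i₀ j * f ⟨(i₀, j), by simp⟩) ^ 2) := by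
      fun_prop
    have hψ : Measurable
        fun f : ((s ×ˢ (Finset.univ : Finset κ) : Finset (ι × κ)) → ℝ) =>
          Real.exp (∑ i : s, (∑ j, a i j ^ 2 - (∑ j, a i j * f ⟨(i, j), by simp⟩) ^ 2)) := by
      fun_prop
    have hind' := hind.comp hφ hψ
    have hm : ∀ i, Measurable fun ω => ∑ j, a i j * σ (i, j) ω := fun i =>
      Finset.measurable_fun_sum _ fun j _ => (hσ (i, j)).measurable.const_mul _
    have hprod := hind'.integral_fun_mul_eq_mul_integral
      (by
        refine Measurable.aestronglyMeasurable ?_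
        have := hm i₀
        change Measurable fun ω => Real.exp (∑ j, a i₀ j ^ 2 - (∑ j, a i₀ j * σ (i₀, j) ω) ^ 2)
        fun_prop)
      (by
        refine Measurable.aestronglyMeasurable ?_
        change Measurable fun ω => Real.exp (∑ i : s, (∑ j, a i j ^ 2
          - (∑ j, a i j * σ (i, j) ω) ^ 2))
        fun_prop)
    have e : ∀ ω, ∑ i : s, (∑ j, a i j ^ 2 - (∑ j, a i j * σ (i, j) ω) ^ 2)
        = ∑ i ∈ s, (∑ j, a i j ^ 2 - (∑ j, a i j * σ (i, j) ω) ^ 2) := fun ω =>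
      Finset.sum_coe_sort s fun i => (∑ j, a i j ^ 2 - (∑ j, a i j * σ (i, j) ω) ^ 2)
    simp only [Function.comp_def] at hprod
    simp only [e] at hprod
    simp only [Finset.sum_insert hs, Real.exp_add, mul_add]
    rw [hprod]
    exact mul_le_mul hrow ih (integral_nonneg fun _ => (Real.exp_pos _).le) (Real.exp_pos _).le

/-- Chernoff's bound with exponential parameter 1; the hypothesis that row variances are at most 1
makes this parameter admissible. -/
theorem measure_sum_rows_le [IsProbabilityMeasure μ] [Fintype ι] {σ : ι × κ → Ω → ℝ}
    (hσ : ∀ i, IsRademacher μ (σ i)) (hi : iIndepFun σ μ) (a : ι → κ → ℝ)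
    (hv : ∀ i, ∑ j, a i j ^ 2 ≤ 1) (t : ℝ) :
    μ {ω | ∑ i, (∑ j, a i j * σ (i, j) ω) ^ 2 ≤ ∑ i, ∑ j, a i j ^ 2 - t}
      ≤ ENNReal.ofReal
        (Real.exp (2 * ∑ i, ((∑ j, a i j ^ 2) ^ 2 - ∑ j, a i j ^ 4) - t)) := by
  set Z : Ω → ℝ := fun ω => ∑ i, (∑ j, a i j ^ 2 - (∑ j, a i j * σ (i, j) ω) ^ 2) with hZ
  have hm : ∀ i, Measurable fun ω => ∑ j, a i j * σ (i, j) ω := fun i =>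
    Finset.measurable_fun_sum _ fun j _ => (hσ (i, j)).measurable.const_mul _
  have hint : Integrable (fun ω => Real.exp (Z ω)) μ := by
    refine Integrable.of_bound (by fun_prop) (Real.exp (∑ i, ∑ j, a i j ^ 2))
      (ae_of_all _ fun ω => ?_)
    rw [Real.norm_eq_abs, Real.abs_exp, Real.exp_le_exp]
    exact Finset.sum_le_sum fun i _ => sub_le_self _ (sq_nonneg _)
  have hset : {ω | ∑ i, (∑ j, a i j * σ (i, j) ω) ^ 2 ≤ ∑ i, ∑ j, a i j ^ 2 - t}
      = {ω | t ≤ Z ω} := by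
    ext ω
    simp only [Set.mem_ofPred_eq, hZ, Finset.sum_sub_distrib]
    constructor <;> intro h <;> linarith
  have h1 := measure_ge_le_exp_mul_mgf (μ := μ) (X := Z) t zero_le_one (by simpa using hint)
  have h2 := integral_exp_sum_rows_le hσ hi a hv Finset.univ
  rw [hset, ← ofReal_measureReal]
  refine ENNReal.ofReal_le_ofReal (h1.trans ?_)
  rw [sub_eq_neg_add, Real.exp_add]
  simp only [mgf, one_mul, neg_mul]
  exact mul_le_mul_of_nonneg_left h2 (Real.exp_pos _).le

end Signs

/-! ### Column overlaps and off-diagonal energy of the sparsity pattern. -/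

section Pattern

variable {Ω : Type*} [MeasurableSpace Ω] {μ : Measure Ω}

/-- With b indices where the indicator is 1, the right side counts ordered m-tuples of distinct such
indices, b(b-1)⋯(b-m+1), and each factor is at least b - m. The shifted power is thus controlled by
mixed moments of order m alone. -/
theorem pow_sub_le_factorial_mul_sum_prod {ι : Type*} [Fintype ι] (b : ι → ℝ)
    (hb : ∀ i, b i = 0 ∨ b i = 1) (m : ℕ) :
    (max (∑ i, b i - m) 0) ^ m
      ≤ m.factorial * ∑ I ∈ Finset.powersetCard m Finset.univ, ∏ i ∈ I, b i := by
  classical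
  set B := Finset.univ.filter fun i => b i = 1 with hB
  have hbi : ∀ i, b i = if i ∈ B then 1 else 0 := fun i => by
    rcases hb i with h | h <;> simp [hB, h]
  have hsum : ∑ i, b i = (B.card : ℝ) := by
    rw [Finset.sum_congr rfl fun i _ => hbi i]
    simp
  have hprod : ∀ I : Finset ι, ∏ i ∈ I, b i = if I ⊆ B then 1 else 0 := fun I => by
    rw [Finset.prod_congr rfl fun i _ => hbi i, Finset.prod_ite_zero]
    simp [Finset.subset_iff]
  have hfil : (Finset.powersetCard m Finset.univ).filter (· ⊆ B) = Finset.powersetCard m B := by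
    ext I
    simp [Finset.mem_powersetCard, and_comm]
  have hmax : max ((B.card : ℝ) - m) 0 = ((B.card - m : ℕ) : ℝ) := by
    rcases le_total m B.card with h | h
    · rw [Nat.cast_sub h, max_eq_left]
      simpa using h
    · rw [Nat.sub_eq_zero_of_le h, max_eq_right]
      · simp
      · simpa using h
  rw [Finset.sum_congr rfl fun I _ => hprod I, ← Finset.sum_filter, hfil, hsum, hmax]
  simp only [Finset.sum_const, Finset.card_powersetCard, nsmul_eq_mul, mul_one]
  -- The falling factorial even dominates (b + 1 - m)^m; the extra 1 is given away.
  exact_mod_cast ((Nat.pow_le_pow_left (by omega) m).trans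
    (B.card.pow_sub_le_descFactorial m)).trans_eq (B.card.descFactorial_eq_factorial_mul_choose m)

variable {p n : ℕ} {ε β : ℝ} {S : Ω → Matrix (Fin p) (Fin n) ℝ} {r : ℕ} {ℓ : ℝ}
  {η σ : Fin p × Fin n → Ω → ℝ}

theorem IsHashingConstruction.rows_pos (h : IsHashingConstruction μ ε β S r ℓ η σ) :
    0 < (p : ℝ) := by
  have hr : (0 : ℝ) < r := by exact_mod_cast h.r_pos
  have := h.two_le
  exact lt_of_lt_of_le (by positivity) h.rows_ge

theorem IsHashingConstruction.sq_div_rows_le (h : IsHashingConstruction μ ε β S r ℓ η σ) :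
    (r : ℝ) ^ 2 / p ≤ Real.exp 1 * ℓ / 2 := by
  have hp := h.rows_pos
  have := h.two_le
  have he := Real.exp_pos 1
  have hr := h.rows_ge
  rw [div_le_iff₀ (by positivity)] at hr
  rw [div_le_iff₀ hp]
  linarith

theorem IsHashingConstruction.integrable_prod [IsProbabilityMeasure μ]
    (h : IsHashingConstruction μ ε β S r ℓ η σ) (T : Finset (Fin p × Fin n)) :
    Integrable (fun ω => ∏ a ∈ T, η a ω) μ := by
  refine Integrable.of_bound
    (Finset.measurable_fun_prod _ fun a _ => h.measurable_indicator a).aestronglyMeasurable 1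
    (ae_of_all _ fun ω => ?_)
  rw [norm_prod]
  refine Finset.prod_le_one (fun _ _ => norm_nonneg _) fun a _ => ?_
  rcases h.indicator a ω with h | h <;> simp [h]

/-- Moment bound for the number of common nonzero entries of two columns. -/
theorem IsHashingConstruction.integral_overlap_le [IsProbabilityMeasure μ]
    (h : IsHashingConstruction μ ε β S r ℓ η σ) {j k : Fin n} (hjk : j ≠ k) {m : ℕ}
    (hm : 2 * (m : ℝ) ≤ ℓ) :
    ∫ ω, (max (∑ i, η (i, j) ω * η (i, k) ω - m) 0) ^ m ∂μ ≤ ((r : ℝ) ^ 2 / p) ^ m := by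
  classical
  have hp := h.rows_pos
  have hT : ∀ (I : Finset (Fin p)) ω, ∏ i ∈ I, η (i, j) ω * η (i, k) ω
      = ∏ a ∈ I ×ˢ {j, k}, η a ω := fun I ω => by
    rw [Finset.prod_product]
    exact Finset.prod_congr rfl fun i _ => (Finset.prod_pair (f := fun b => η (i, b) ω) hjk).symm
  have hcard : ∀ I ∈ Finset.powersetCard m (Finset.univ : Finset (Fin p)),
      (I ×ˢ ({j, k} : Finset (Fin n))).card = 2 * m := fun I hI => by
    rw [Finset.card_product, Finset.card_pair hjk, (Finset.mem_powersetCard.1 hI).2, mul_comm]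
  have hint : Integrable (fun ω => (m.factorial : ℝ) * ∑ I ∈ Finset.powersetCard m
      (Finset.univ : Finset (Fin p)), ∏ a ∈ I ×ˢ ({j, k} : Finset (Fin n)), η a ω) μ :=
    (integrable_finsetSum _ fun I _ => h.integrable_prod _).const_mul _
  calc ∫ ω, (max (∑ i, η (i, j) ω * η (i, k) ω - m) 0) ^ m ∂μ
      ≤ ∫ ω, (m.factorial : ℝ) * ∑ I ∈ Finset.powersetCard m (Finset.univ : Finset (Fin p)),
          ∏ a ∈ I ×ˢ ({j, k} : Finset (Fin n)), η a ω ∂μ := by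
        refine integral_mono_of_nonneg (ae_of_all _ fun ω => by positivity) hint
          (ae_of_all _ fun ω => ?_)
        simp only [← hT]
        refine pow_sub_le_factorial_mul_sum_prod _ (fun i => ?_) m
        rcases h.indicator (i, j) ω with h1 | h1 <;> rcases h.indicator (i, k) ω with h2 | h2 <;>
          simp [h1, h2]
    _ = m.factorial * ∑ I ∈ Finset.powersetCard m (Finset.univ : Finset (Fin p)),
          ∫ ω, ∏ a ∈ I ×ˢ ({j, k} : Finset (Fin n)), η a ω ∂μ := by
        rw [integral_const_mul, integral_finsetSum _ fun I _ => h.integrable_prod _]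
    _ ≤ m.factorial * ∑ I ∈ Finset.powersetCard m (Finset.univ : Finset (Fin p)),
          ((r : ℝ) / p) ^ (2 * m) := by
        refine mul_le_mul_of_nonneg_left (Finset.sum_le_sum fun I hI => ?_) (by positivity)
        -- The product runs over 2m distinct entries, m rows in two distinct columns; hence the
        -- condition 2m ≤ ℓ.
        have := h.neg_corr (I ×ˢ {j, k}) (by rw [hcard I hI]; push_cast; exact hm)
        rwa [hcard I hI] at this
    _ = (p.descFactorial m : ℝ) * ((r : ℝ) / p) ^ (2 * m) := by
        rw [Finset.sum_const, Finset.card_powersetCard, Finset.card_fin, nsmul_eq_mul, ← mul_assoc,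
          Nat.descFactorial_eq_factorial_mul_choose]
        push_cast
        rfl
    _ ≤ (p : ℝ) ^ m * ((r : ℝ) / p) ^ (2 * m) :=
        mul_le_mul_of_nonneg_right (by exact_mod_cast Nat.descFactorial_le_pow p m)
          (by positivity)
    _ = ((r : ℝ) ^ 2 / p) ^ m := by
        rw [pow_mul, ← mul_pow]
        congr 1
        field_simp

/-- The off-diagonal energy `∑_{j ≠ k} x_j² x_k² ∑_i h_ij² h_ik²` of a pattern `h`. -/
def patternEnergy (x : Fin n → ℝ) (h : Fin p × Fin n → ℝ) : ℝ :=
  ∑ i, ((∑ j, (h (i, j) * x j) ^ 2) ^ 2 - ∑ j, (h (i, j) * x j) ^ 4)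

theorem measurable_patternEnergy (x : Fin n → ℝ) :
    Measurable (patternEnergy x : (Fin p × Fin n → ℝ) → ℝ) := by
  unfold patternEnergy
  fun_prop

theorem patternEnergy_eq (x : Fin n → ℝ) (h : Fin p × Fin n → ℝ)
    (hh : ∀ a, h a = 0 ∨ h a = 1) :
    patternEnergy x h = ∑ b : Fin n × Fin n,
      if b.1 = b.2 then 0 else x b.1 ^ 2 * x b.2 ^ 2 * ∑ i, h (i, b.1) * h (i, b.2) := by
  have hsq : ∀ a, h a ^ 2 = h a := fun a => by rcases hh a with h | h <;> simp [h]
  have hsplit : ∀ b : Fin n × Fin n,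
      (if b.1 = b.2 then 0 else x b.1 ^ 2 * x b.2 ^ 2 * ∑ i, h (i, b.1) * h (i, b.2))
      = ∑ i, ((h (i, b.1) * x b.1) ^ 2 * (h (i, b.2) * x b.2) ^ 2
        - if b.1 = b.2 then (h (i, b.1) * x b.1) ^ 4 else 0) := fun b => by
    split_ifs with hb
    · symm
      refine Finset.sum_eq_zero fun i _ => ?_
      rw [← hb]
      ring
    · rw [Finset.mul_sum]
      refine Finset.sum_congr rfl fun i _ => ?_
      rw [mul_pow, mul_pow, hsq, hsq]
      ring
  rw [Finset.sum_congr rfl fun b _ => hsplit b, Finset.sum_comm, patternEnergy]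
  refine Finset.sum_congr rfl fun i _ => ?_
  rw [Finset.sum_sub_distrib, Fintype.sum_prod_type, Fintype.sum_prod_type, sq (∑ j, _),
    Finset.sum_mul_sum]
  simp

/-- Upper tail of the off-diagonal energy. -/
theorem IsHashingConstruction.measure_patternEnergy_ge_le [IsProbabilityMeasure μ]
    (h : IsHashingConstruction μ ε β S r ℓ η σ) (x : Fin n → ℝ) (hx : ∑ j, x j ^ 2 = 1) {m : ℕ}
    (hm : 2 * (m : ℝ) ≤ ℓ) {c : ℝ} (hc : 0 < c) :
    μ {ω | m + c ≤ patternEnergy x fun a => η a ω}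
      ≤ ENNReal.ofReal (((r : ℝ) ^ 2 / p) ^ m / c ^ m) := by
  set z : Fin n × Fin n → Ω → ℝ := fun b ω =>
    if b.1 = b.2 then 0 else max (∑ i, η (i, b.1) ω * η (i, b.2) ω - m) 0 with hz
  -- The diagonal pairs keep their weights, so that the weights sum to exactly 1 as Jensen's
  -- inequality requires; the diagonal is removed by setting `z` to 0 there.
  set w : Fin n × Fin n → ℝ := fun b => x b.1 ^ 2 * x b.2 ^ 2 with hw
  have hw0 : ∀ b, 0 ≤ w b := fun b => by positivity
  have hz0 : ∀ b ω, 0 ≤ z b ω := fun b ω => by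
    simp only [hz]
    split_ifs
    exacts [le_rfl, le_max_right _ _]
  have hw1 : ∑ b, w b = 1 := by
    simp only [hw, Fintype.sum_prod_type]
    rw [← Finset.sum_mul_sum, hx, one_mul]
  have hzm : ∀ b, Measurable (z b) := fun b => by
    simp only [hz]
    split_ifs
    · exact measurable_const
    · exact ((Finset.measurable_fun_sum _ fun i _ => (h.measurable_indicator _).mul
        (h.measurable_indicator _)).sub_const _).max measurable_const
  have hzp : ∀ b ω, z b ω ≤ p := fun b ω => by
    simp only [hz]
    split_ifs
    · positivity
    · refine max_le ?_ (by positivity)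
      have : ∑ i, η (i, b.1) ω * η (i, b.2) ω ≤ ∑ i : Fin p, (1 : ℝ) := by
        refine Finset.sum_le_sum fun i _ => ?_
        rcases h.indicator (i, b.1) ω with h1 | h1 <;>
          rcases h.indicator (i, b.2) ω with h2 | h2 <;> simp [h1, h2]
      have hm0 : (0 : ℝ) ≤ m := by positivity
      simp only [Finset.sum_const, Finset.card_fin, nsmul_eq_mul, mul_one] at this
      linarith
  have hzint : ∀ b, Integrable (fun ω => z b ω ^ m) μ := fun b => by
    refine Integrable.of_bound ((hzm b).pow_const m).aestronglyMeasurable ((p : ℝ) ^ m)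
      (ae_of_all _ fun ω => ?_)
    rw [Real.norm_of_nonneg (pow_nonneg (hz0 b ω) m)]
    exact pow_le_pow_left₀ (hz0 b ω) (hzp b ω) m
  have hzE : ∀ b, ∫ ω, z b ω ^ m ∂μ ≤ ((r : ℝ) ^ 2 / p) ^ m := fun b => by
    by_cases hb : b.1 = b.2
    · rcases Nat.eq_zero_or_pos m with rfl | hm0
      · simp
      · simp only [hz, hb, if_true, zero_pow hm0.ne', integral_zero]
        positivity
    · simp only [hz, if_neg hb]
      exact h.integral_overlap_le hb hm
  have hE : ∀ ω, patternEnergy x (fun a => η a ω) - m ≤ ∑ b, w b * z b ω := fun ω => by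
    rw [patternEnergy_eq x _ fun a => h.indicator a ω]
    have : (m : ℝ) = ∑ b, w b * m := by rw [← Finset.sum_mul, hw1, one_mul]
    rw [this, ← Finset.sum_sub_distrib]
    refine Finset.sum_le_sum fun b _ => ?_
    simp only [hz]
    split_ifs with hb
    · have := hw0 b
      simp
      positivity
    · rw [← mul_sub]
      exact mul_le_mul_of_nonneg_left (le_max_left _ _) (hw0 b)
  -- Convexity of the m-th power moves it inside the average, after which Markov's inequality needs
  -- only the moments of single overlaps.
  have hsub : {ω | m + c ≤ patternEnergy x fun a => η a ω}
      ⊆ {ω | c ^ m ≤ ∑ b, w b * z b ω ^ m} := fun ω hω => by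
    have h1 : c ≤ ∑ b, w b * z b ω := by
      have : m + c ≤ patternEnergy x fun a => η a ω := hω
      linarith [hE ω]
    exact (pow_le_pow_left₀ hc.le h1 m).trans
      (Real.pow_arith_mean_le_arith_mean_pow _ _ _ (fun b _ => hw0 b) hw1 (fun b _ => hz0 b ω) m)
  refine (measure_mono hsub).trans ?_
  rw [← ofReal_measureReal]
  refine ENNReal.ofReal_le_ofReal ?_
  rw [le_div_iff₀ (pow_pos hc m), mul_comm]
  have hint : Integrable (fun ω => ∑ b, w b * z b ω ^ m) μ :=
    integrable_finsetSum _ fun b _ => (hzint b).const_mul _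
  refine (mul_meas_ge_le_integral_of_nonneg (ae_of_all _ fun ω =>
    Finset.sum_nonneg fun b _ => mul_nonneg (hw0 b) (pow_nonneg (hz0 b ω) m)) hint _).trans ?_
  rw [integral_finsetSum _ fun b _ => (hzint b).const_mul _]
  calc ∑ b, ∫ ω, w b * z b ω ^ m ∂μ ≤ ∑ b, w b * ((r : ℝ) ^ 2 / p) ^ m := by
        refine Finset.sum_le_sum fun b _ => ?_
        rw [integral_const_mul]
        exact mul_le_mul_of_nonneg_left (hzE b) (hw0 b)
    _ = _ := by rw [← Finset.sum_mul, hw1, one_mul]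

end Pattern

/-! ### The lower tail of ‖S u‖ for a fixed vector u. -/

section FixedVector

variable {Ω : Type*} [MeasurableSpace Ω] {μ : Measure Ω}

/-- Conditioning on an independent variable: a bound on the sections of an event that is uniform
over `G` bounds the part of the event over `G`. -/
theorem measure_inter_fiber_le [IsProbabilityMeasure μ] {𝓧 𝓨 : Type*} [MeasurableSpace 𝓧]
    [MeasurableSpace 𝓨] {X : Ω → 𝓧} {Y : Ω → 𝓨} (hX : Measurable X) (hY : Measurable Y)
    (hXY : IndepFun X Y μ) {G : Set 𝓨} (hG : MeasurableSet G) {E : Set (𝓧 × 𝓨)}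
    (hE : MeasurableSet E) {c : ENNReal} (hc : ∀ y ∈ G, μ {ω | (X ω, y) ∈ E} ≤ c) :
    μ {ω | Y ω ∈ G ∧ (X ω, Y ω) ∈ E} ≤ c * μ (Y ⁻¹' G) := by
  have := Measure.isProbabilityMeasure_map (μ := μ) hX.aemeasurable
  have := Measure.isProbabilityMeasure_map (μ := μ) hY.aemeasurable
  have hEG : MeasurableSet (E ∩ Prod.snd ⁻¹' G) := hE.inter (measurable_snd hG)
  have hset : {ω | Y ω ∈ G ∧ (X ω, Y ω) ∈ E} = (fun ω => (X ω, Y ω)) ⁻¹' (E ∩ Prod.snd ⁻¹' G) := by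
    ext ω
    exact and_comm
  rw [hset, ← Measure.map_apply (hX.prodMk hY) hEG,
    (indepFun_iff_map_prod_eq_prod_map_map hX.aemeasurable hY.aemeasurable).1 hXY,
    Measure.prod_apply_symm hEG, ← Measure.map_apply hY hG, ← lintegral_indicator_const hG]
  refine lintegral_mono fun y => ?_
  rw [Measure.map_apply hX (measurable_prodMk_right hEG)]
  by_cases hy : y ∈ G
  · rw [Set.indicator_of_mem hy]
    exact (measure_mono fun ω hω => hω.1).trans (hc y hy)
  · rw [Set.indicator_of_notMem hy]
    refine (measure_mono (t := ∅) fun ω hω => hy hω.2).trans (by simp)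

variable {p n : ℕ} {α β : ℝ} {S : Ω → Matrix (Fin p) (Fin n) ℝ} {r : ℕ} {ℓ : ℝ}
  {η σ : Fin p × Fin n → Ω → ℝ}

/-- The left side is ℓ plus twice the energy threshold, so the Chernoff exponent falls to -ℓ or
below. There is ample room: √e ≥ 1, e < 3 and 1 ≤ e⁴ bound the left side by 5e⁴ℓ, against 8e⁴(ℓ +
1). -/
theorem IsHashingConstruction.order_le_sparsity {ε : ℝ}
    (h : IsHashingConstruction μ ε β S r ℓ η σ) (hε : ε ∈ Set.Ioo (0 : ℝ) 1) :
    ℓ + 2 * (ℓ / 2 + Real.exp 4 * (Real.exp 1 * ℓ / 2)) ≤ r * (2 * ε - ε ^ 2) := by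
  have hδ : 0 < 2 * ε - ε ^ 2 := by nlinarith [hε.1, hε.2]
  have hs := h.sparsity_ge
  rw [div_le_iff₀ hδ] at hs
  refine le_trans ?_ hs
  have hl := h.two_le
  have h1 : (1 : ℝ) ≤ √(Real.exp 1) := Real.one_le_sqrt.2 (Real.one_le_exp zero_le_one)
  have h4 : (1 : ℝ) ≤ Real.exp 4 := Real.one_le_exp (by norm_num)
  have he := Real.exp_one_lt_d9
  have a1 : 8 * Real.exp 4 * 1 * (ℓ + 1) ≤ 8 * Real.exp 4 * √(Real.exp 1) * (ℓ + 1) := by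
    gcongr
  have a2 : Real.exp 4 * (Real.exp 1 * ℓ) ≤ Real.exp 4 * (3 * ℓ) := by
    gcongr
    linarith
  have a3 : 1 * ℓ ≤ Real.exp 4 * ℓ := by gcongr
  nlinarith

/-- The choice of ℓ gives (ℓ + 1)ℓ/2 ≤ β exp ℓ, and ℓ ≥ 2 makes the left side at least 3. -/
theorem IsHashingConstruction.exp_neg_order_le
    {ε : ℝ} (h : IsHashingConstruction μ ε β S r ℓ η σ) (hβ : 0 < β) :
    2 * Real.exp (-ℓ) ≤ β := by
  have hl := h.two_le
  have h1 := h.order_ge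
  rw [Real.log_le_iff_le_exp (by positivity), inv_mul_le_iff₀ hβ] at h1
  rw [Real.exp_neg, ← div_eq_mul_inv, div_le_iff₀ (Real.exp_pos ℓ)]
  nlinarith

/-- A sparse pattern with small off-diagonal energy keeps the norm of a unit vector. -/
theorem measure_sign_sum_le_of_pattern [IsProbabilityMeasure μ]
    (hσ : ∀ a, IsRademacher μ (σ a)) (hi : iIndepFun σ μ) (x : Fin n → ℝ)
    (hx : ∑ j, x j ^ 2 = 1) {g : Fin p × Fin n → ℝ} (hg : ∀ a, g a = 0 ∨ g a = 1)
    (hsum : ∀ j, ∑ i, g (i, j) = r) (t : ℝ) :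
    μ {ω | ∑ i, (∑ j, g (i, j) * x j * σ (i, j) ω) ^ 2 ≤ r - t}
      ≤ ENNReal.ofReal (Real.exp (2 * patternEnergy x g - t)) := by
  have hsq : ∀ a, g a ^ 2 = g a := fun a => by rcases hg a with h | h <;> simp [h]
  have hle : ∀ a, g a ≤ 1 := fun a => by rcases hg a with h | h <;> simp [h]
  have hr : ∑ i, ∑ j, (g (i, j) * x j) ^ 2 = r := by
    rw [Finset.sum_comm]
    simp only [mul_pow, hsq, ← Finset.sum_mul, hsum]
    rw [← Finset.mul_sum, hx, mul_one]
  have := measure_sum_rows_le hσ hi (fun i j => g (i, j) * x j) (fun i => by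
    rw [← hx]
    refine Finset.sum_le_sum fun j _ => ?_
    rw [mul_pow, hsq]
    exact mul_le_of_le_one_left (sq_nonneg _) (hle _)) t
  rwa [hr] at this

theorem IsHashingConstruction.norm_sq (h : IsHashingConstruction μ (1 - α) β S r ℓ η σ)
    (x : Fin n → ℝ) (ω : Ω) :
    r * ‖WithLp.toLp 2 (S ω *ᵥ x)‖ ^ 2 = ∑ i, (∑ j, η (i, j) ω * x j * σ (i, j) ω) ^ 2 := by
  have hr : (0 : ℝ) < r := by exact_mod_cast h.r_pos
  have hi : ∀ i, (S ω *ᵥ x) i = 1 / √(r : ℝ) * ∑ j, η (i, j) ω * x j * σ (i, j) ω := fun i => by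
    rw [Matrix.mulVec, dotProduct, Finset.mul_sum]
    refine Finset.sum_congr rfl fun j _ => ?_
    rw [h.entry]
    ring
  rw [EuclideanSpace.real_norm_sq_eq]
  simp only [hi, mul_pow, ← Finset.mul_sum, div_pow, Real.sq_sqrt hr.le]
  field_simp

/-- The failure event is covered by three others: a good pattern with bad signs, a pattern of large
energy, and the null event of wrong column sums. -/
theorem IsHashingConstruction.measure_norm_lt_of_unit [IsProbabilityMeasure μ]
    (h : IsHashingConstruction μ (1 - α) β S r ℓ η σ) (hα : α ∈ Set.Ioo (0 : ℝ) 1) (hβ : 0 < β)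
    (x : Fin n → ℝ) (hx : ∑ j, x j ^ 2 = 1) :
    μ {ω | ‖WithLp.toLp 2 (S ω *ᵥ x)‖ < α} ≤ ENNReal.ofReal β := by
  have hl := h.two_le
  -- The largest moment order that negative correlation of order ℓ allows for pairs of columns.
  set m : ℕ := ⌊ℓ / 2⌋₊ with hm
  have hm1 : (m : ℝ) ≤ ℓ / 2 := Nat.floor_le (by linarith)
  have hm2 : ℓ / 2 < m + 1 := Nat.lt_floor_add_one _
  have hm3 : (1 : ℝ) ≤ m := by
    have : 1 ≤ m := Nat.le_floor (by push_cast; linarith)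
    exact_mod_cast this
  set L : ℝ := Real.exp 1 * ℓ / 2 with hL
  have hL0 : 0 < L := by positivity
  -- As r²/p ≤ L, the threshold e⁴L makes the tail bound at most exp(-4m).
  set c : ℝ := Real.exp 4 * L with hc
  have hc0 : 0 < c := by positivity
  set t : ℝ := r * (1 - α ^ 2) with ht
  set G : Set (Fin p × Fin n → ℝ) := {g | (∀ a, g a = 0 ∨ g a = 1) ∧
    (∀ j, ∑ i, g (i, j) = r) ∧ patternEnergy x g < m + c} with hG
  set E : Set ((Fin p × Fin n → ℝ) × (Fin p × Fin n → ℝ)) :=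
    {q | ∑ i, (∑ j, q.2 (i, j) * x j * q.1 (i, j)) ^ 2 ≤ r - t} with hE
  have hEm : MeasurableSet E := measurableSet_le (by fun_prop) (by fun_prop)
  have hGm : MeasurableSet G := by
    have hGeq : G = (⋂ a, {g | g a = 0 ∨ g a = 1}) ∩ ((⋂ j, {g | ∑ i, g (i, j) = (r : ℝ)})
        ∩ {g | patternEnergy x g < m + c}) := by
      ext g
      simp [hG]
    rw [hGeq]
    refine MeasurableSet.inter (MeasurableSet.iInter fun a => ?_) (MeasurableSet.inter
      (MeasurableSet.iInter fun j => measurableSet_eq_fun (by fun_prop) measurable_const)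
      (measurableSet_lt (measurable_patternEnergy x) measurable_const))
    exact ((measurable_pi_apply a) (measurableSet_singleton 0)).union
      ((measurable_pi_apply a) (measurableSet_singleton 1))
  have hfib : μ {ω | (fun a => η a ω) ∈ G ∧ ((fun a => σ a ω), fun a => η a ω) ∈ E}
      ≤ ENNReal.ofReal (Real.exp (-ℓ)) := by
    have := measure_inter_fiber_le (μ := μ) (X := fun ω a => σ a ω) (Y := fun ω a => η a ω)
      (measurable_pi_lambda _ fun a => (h.rademacher a).measurable)
      (measurable_pi_lambda _ fun a => h.measurable_indicator a) h.indep_pattern hGm hEm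
      (c := ENNReal.ofReal (Real.exp (-ℓ))) fun g hg => by
        refine (measure_sign_sum_le_of_pattern h.rademacher h.indep_signs x hx hg.1 hg.2.1
          t).trans (ENNReal.ofReal_le_ofReal (Real.exp_le_exp.2 ?_))
        have h1 := h.order_le_sparsity ⟨by linarith [hα.2], by linarith [hα.1]⟩
        -- With ε = 1 - α, the denominator 2ε - ε² in the sparsity condition is exactly 1 - α².
        have h2 : t = r * (2 * (1 - α) - (1 - α) ^ 2) := by rw [ht]; ring
        have h3 := hg.2.2
        rw [← hL, ← hc] at h1
        rw [h2]
        linarith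
    exact this.trans (mul_le_of_le_one_right' prob_le_one)
  have htail : μ {ω | m + c ≤ patternEnergy x fun a => η a ω}
      ≤ ENNReal.ofReal (Real.exp (-ℓ)) := by
    refine (h.measure_patternEnergy_ge_le x hx (by linarith) hc0).trans
      (ENNReal.ofReal_le_ofReal ?_)
    have hrp := h.rows_pos
    calc ((r : ℝ) ^ 2 / p) ^ m / c ^ m ≤ L ^ m / c ^ m := by
          gcongr
          exact h.sq_div_rows_le
      _ = Real.exp (-4) ^ m := by
          rw [hc, mul_pow, Real.exp_neg, inv_pow]
          field_simp
      _ ≤ Real.exp (-ℓ) := by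
          -- 4m ≥ ℓ holds despite the rounding: m ≥ 1 gives 2m ≥ m + 1 > ℓ/2.
          rw [← Real.exp_nat_mul, Real.exp_le_exp]
          linarith
  have hcol : μ {ω | ¬ ∀ j, ∑ i, η (i, j) ω = r} = 0 := ae_all_iff.2 h.column_sum
  have hsub : {ω | ‖WithLp.toLp 2 (S ω *ᵥ x)‖ < α}
      ⊆ {ω | (fun a => η a ω) ∈ G ∧ ((fun a => σ a ω), fun a => η a ω) ∈ E}
        ∪ {ω | m + c ≤ patternEnergy x fun a => η a ω}
        ∪ {ω | ¬ ∀ j, ∑ i, η (i, j) ω = r} := fun ω hω => by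
    by_cases h1 : ∀ j, ∑ i, η (i, j) ω = r
    · left
      by_cases h2 : m + c ≤ patternEnergy x fun a => η a ω
      · exact Or.inr h2
      · refine Or.inl ⟨⟨fun a => h.indicator a ω, h1, not_le.1 h2⟩, ?_⟩
        change ∑ i, (∑ j, η (i, j) ω * x j * σ (i, j) ω) ^ 2 ≤ r - t
        rw [← h.norm_sq x ω, ht, mul_sub, mul_one, sub_sub_cancel]
        exact mul_le_mul_of_nonneg_left (pow_le_pow_left₀ (norm_nonneg _) (le_of_lt hω) 2)
          (by positivity)
    · exact Or.inr h1
  calc μ {ω | ‖WithLp.toLp 2 (S ω *ᵥ x)‖ < α}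
      ≤ ENNReal.ofReal (Real.exp (-ℓ)) + ENNReal.ofReal (Real.exp (-ℓ)) + 0 :=
        (measure_mono hsub).trans ((measure_union_le _ _).trans (add_le_add
          ((measure_union_le _ _).trans (add_le_add hfib htail)) hcol.le))
    _ = ENNReal.ofReal (2 * Real.exp (-ℓ)) := by
        rw [add_zero, ← ENNReal.ofReal_add (Real.exp_pos _).le (Real.exp_pos _).le, two_mul]
    _ ≤ ENNReal.ofReal β := ENNReal.ofReal_le_ofReal (h.exp_neg_order_le hβ)

/-- Lower tail of the Johnson--Lindenstrauss property of hashing matrices. -/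
theorem IsHashingMatrix.measure_norm_lt_le [IsProbabilityMeasure μ]
    (h : IsHashingMatrix μ (1 - α) β S) (hα : α ∈ Set.Ioo (0 : ℝ) 1) (hβ : 0 < β)
    (u : EuclideanSpace ℝ (Fin n)) :
    μ {ω | ‖WithLp.toLp 2 (S ω *ᵥ u.ofLp)‖ < α * ‖u‖} ≤ ENNReal.ofReal β := by
  obtain ⟨r, ℓ, η, σ, h⟩ := h
  rcases eq_or_ne u 0 with rfl | hu
  · simp
  · have hn : 0 < ‖u‖ := norm_pos_iff.2 hu
    have hx : ∑ j, (‖u‖⁻¹ • u.ofLp) j ^ 2 = 1 := by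
      simp only [Pi.smul_apply, smul_eq_mul, mul_pow, ← Finset.mul_sum]
      rw [← EuclideanSpace.real_norm_sq_eq]
      field_simp
    refine le_trans (measure_mono fun ω hω => ?_) (h.measure_norm_lt_of_unit hα hβ _ hx)
    change ‖WithLp.toLp 2 (S ω *ᵥ (‖u‖⁻¹ • u.ofLp))‖ < α
    rw [Matrix.mulVec_smul, WithLp.toLp_smul, norm_smul, norm_inv, norm_norm,
      inv_mul_lt_iff₀ hn, mul_comm]
    exact hω

end FixedVector

/-! ### From fixed vectors to vectors determined by the past. -/

namespace SubspaceMethod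

variable {Ω : Type*} {Θ : Type*} [MeasurableSpace Θ] {θ : Ω → Θ} {n p : ℕ}
  {A : SubspaceMethod Ω n p}

theorem noiseAndMatrices_mono {k l : ℕ} (hkl : k ≤ l) :
    A.noiseAndMatrices θ k ≤ A.noiseAndMatrices θ l :=
  sup_le_sup le_rfl (iSup_le fun i => le_iSup (fun i : Fin l => ⨆ (a : Fin n) (b : Fin p),
    MeasurableSpace.comap (fun ω => A.Q i ω a b) inferInstance) (Fin.castLE hkl i))

theorem comap_matrix_le_noiseAndMatrices {k l : ℕ} (hkl : l < k) :
    (⨆ (i : Fin n) (j : Fin p), MeasurableSpace.comap (fun ω => A.Q l ω i j) inferInstance)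
      ≤ A.noiseAndMatrices θ k :=
  le_sup_of_le_right (le_iSup (fun i : Fin k => ⨆ (a : Fin n) (b : Fin p),
    MeasurableSpace.comap (fun ω => A.Q i ω a b) inferInstance) ⟨l, hkl⟩)

theorem comap_matrix_eq (k : ℕ) :
    MeasurableSpace.comap (fun ω (a : Fin n × Fin p) => A.Q k ω a.1 a.2) inferInstance
      = ⨆ (i : Fin n) (j : Fin p), MeasurableSpace.comap (fun ω => A.Q k ω i j) inferInstance := by
  simp only [MeasurableSpace.pi, MeasurableSpace.comap_iSup, MeasurableSpace.comap_comp,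
    Function.comp_def]
  exact iSup_prod

variable [MeasurableSpace Ω]

/-- Iteration l < k draws on the matrices up to index l only, which all precede `Q k`; the initial
σ-algebra is trivial because x₀ is deterministic. -/
theorem IsDrivenBy.past_le (hA : A.IsDrivenBy θ) (k : ℕ) :
    A.past k ≤ A.noiseAndMatrices θ k := by
  cases k with
  | zero => simp [past, MeasurableSpace.comap_const]
  | succ k =>
    refine iSup_le fun l => ?_
    have hl : A.noiseAndMatrices θ (l + 1) ≤ A.noiseAndMatrices θ (k + 1) :=
      noiseAndMatrices_mono (by omega)
    refine sup_le (sup_le (sup_le ?_ ?_) (iSup_le fun s => ?_))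
      (comap_matrix_le_noiseAndMatrices l.2)
    · exact (hA.est0 l).comap_le.trans hl
    · exact (hA.estS l).comap_le.trans hl
    · exact (hA.model l s).comap_le.trans hl

theorem IsDrivenBy.noiseAndMatrices_le (hA : A.IsDrivenBy θ) (k : ℕ) :
    A.noiseAndMatrices θ k ≤ (inferInstance : MeasurableSpace Ω) :=
  sup_le hA.measurable_noise.comap_le (iSup_le fun l => iSup_le fun i => iSup_le fun j =>
    (hA.measurable_Q l i j).comap_le)

/-- Freezing the past: an independent matrix that is well aligned with every fixed vector is well
aligned with every vector determined by the past. -/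
theorem isWAMAt_of_forall_fixed {μ : Measure Ω} [IsProbabilityMeasure μ] (hA : A.IsDrivenBy θ)
    {α β : ℝ} {k : ℕ} (hβ : 0 ≤ β) (hind : A.IndepOfPast μ θ k)
    (hfix : ∀ u : EuclideanSpace ℝ (Fin n),
      μ {ω | ‖WithLp.toLp 2 ((A.Q k ω)ᵀ *ᵥ u.ofLp)‖ < α * ‖u‖} ≤ ENNReal.ofReal β) :
    A.IsWAMAt μ α β k := by
  intro v hv
  have hle : A.past k ≤ (inferInstance : MeasurableSpace Ω) :=
    (hA.past_le k).trans (hA.noiseAndMatrices_le k)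
  set X : Ω → (Fin n × Fin p → ℝ) := fun ω a => A.Q k ω a.1 a.2 with hX
  have hXm : Measurable X := measurable_pi_lambda _ fun a => hA.measurable_Q k a.1 a.2
  have hXi : Indep (MeasurableSpace.comap X inferInstance) (A.past k) μ := by
    rw [hX, comap_matrix_eq]
    exact indep_of_indep_of_le_right hind (hA.past_le k)
  have hXi' : Indep (MeasurableSpace.comap X inferInstance)
      (MeasurableSpace.comap id (A.past k)) μ := by
    rwa [MeasurableSpace.comap_id]
  have hmul : Measurable fun q : (Fin n × Fin p → ℝ) × EuclideanSpace ℝ (Fin n) =>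
      ‖WithLp.toLp 2 fun j => ∑ i, q.1 (i, j) * q.2 i‖ := by fun_prop
  set F : Set ((Fin n × Fin p → ℝ) × EuclideanSpace ℝ (Fin n)) :=
    {q | ‖WithLp.toLp 2 fun j => ∑ i, q.1 (i, j) * q.2 i‖ < α * ‖q.2‖} with hF
  have hFm : MeasurableSet F := measurableSet_lt hmul (by fun_prop)
  have hcompl : (A.alignEvent α k v)ᶜ = {ω | (X ω, v ω) ∈ F} := by
    ext ω
    exact not_le (α := ℝ)
  have hAm : MeasurableSet (A.alignEvent α k v) := by
    rw [← MeasurableSet.compl_iff, hcompl]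
    exact (hXm.prodMk (hv.mono hle le_rfl)) hFm
  have hbound : ∀ B, MeasurableSet[A.past k] B →
      μ (B ∩ (A.alignEvent α k v)ᶜ) ≤ ENNReal.ofReal β * μ B := by
    intro B hB
    have hFv : @MeasurableSet _ (@Prod.instMeasurableSpace _ _ _ (A.past k))
        {q : (Fin n × Fin p → ℝ) × Ω | (q.1, v q.2) ∈ F} := by
      let _ : MeasurableSpace Ω := A.past k
      exact (measurable_fst.prodMk (hv.comp measurable_snd)) hFm
    -- The frozen variable is the identity into Ω with the σ-algebra `A.past k`: its fibres fix ω,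
    -- hence the value `v ω`, and `hfix` applies to each.
    have := @measure_inter_fiber_le _ _ μ _ _ _ _ (A.past k) X id hXm (measurable_id'' hle)
      hXi' B hB _ hFv (ENNReal.ofReal β) fun y _ => hfix (v y)
    rw [hcompl]
    exact this
  have hAint : Integrable ((A.alignEvent α k v).indicator fun _ => (1 : ℝ)) μ :=
    (integrable_const _).indicator hAm
  -- Both sides are measurable with respect to the past, so it suffices to compare integrals over
  -- past events `B`, where the conditional expectation integrates to the measure of `B` intersected
  -- with the alignment event.
  refine ae_le_of_ae_le_trim (hm := hle) ?_
  refine ae_le_of_forall_setIntegral_le (integrable_const _)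
    (integrable_condExp.trim hle stronglyMeasurable_condExp) fun B hB _ => ?_
  rw [← setIntegral_trim hle stronglyMeasurable_condExp hB,
    ← setIntegral_trim hle stronglyMeasurable_const hB, setIntegral_condExp hle hAint hB,
    setIntegral_indicator hAm, setIntegral_const, setIntegral_const, smul_eq_mul, smul_eq_mul,
    mul_one]
  have h1 : μ.real (B ∩ (A.alignEvent α k v)ᶜ) ≤ β * μ.real B := by
    have := ENNReal.toReal_mono (by finiteness) (hbound B hB)
    rwa [ENNReal.toReal_mul, ENNReal.toReal_ofReal hβ] at this
  have h2 := measureReal_inter_add_sdiff (μ := μ) (s := B) hAm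
  rw [Set.sdiff_eq] at h2
  linarith

end SubspaceMethod

end STARS

theorem mainTheorem8 {Ω : Type*} [MeasurableSpace Ω] (μ : Measure Ω) [IsProbabilityMeasure μ]
    {Θ : Type*} [MeasurableSpace Θ] (θ : Ω → Θ) {n p : ℕ} (A : STARS.SubspaceMethod Ω n p)
    (hA : A.IsDrivenBy θ) (α β : ℝ) (hα : α ∈ Set.Ioo (0 : ℝ) 1)
    (hβ : β ∈ Set.Ioo (0 : ℝ) (1 / 2)) :
    (∀ k : ℕ, STARS.IsHashingMatrix μ (1 - α) β (fun ω => (A.Q k ω)ᵀ) → A.IndepOfPast μ θ k →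
      A.IsWAMAt μ α β k) ∧
    ((∀ k : ℕ, STARS.IsHashingMatrix μ (1 - α) β (fun ω => (A.Q k ω)ᵀ) ∧ A.IndepOfPast μ θ k) →
      A.IsProbWellAligned μ α β) := by
  have main : ∀ k : ℕ, STARS.IsHashingMatrix μ (1 - α) β (fun ω => (A.Q k ω)ᵀ) →
      A.IndepOfPast μ θ k → A.IsWAMAt μ α β k := fun k hk hind =>
    STARS.SubspaceMethod.isWAMAt_of_forall_fixed hA hβ.1.le hind
      fun u => hk.measure_norm_lt_le hα hβ.1 u
  exact ⟨main, fun h k => main k (h k).1 (h k).2⟩
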